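/- Let $K$ be a field of characteristic zero and let $\mathcal A$ be an associative $K$-algebra, not necessarily unital or commutative. A $K$-linear map $\eta:\mathcal A\to\mathcal A$ is called locally finite if for every $a\in\mathcal A$ the $K$-subspace spanned by the elements $\eta^i(a)$ $(i\ge 0)$ is finite dimensional, and locally nilpotent if for every $a\in\mathcal A$ there is $m\ge 1$ with $\eta^m(a)=0$. A $K$-derivation of $\mathcal A$ is a $K$-linear map $D:\mathcal A\to\mathcal A$ with $D(ab)=D(a)b+aD(b)$ for all $a,b\in\mathcal A$. A $K$-$\mathcal E$-derivation of $\mathcal A$ is a $K$-linear map $\delta:\mathcal A\to\mathcal A$ with $\delta(ab)=\delta(a)b+a\delta(b)-\delta(a)\delta(b)$ for all $a,b\in\mathcal A$; equivalently, $\delta=\mathrm{Id}-\phi$ for a (not necessarily unit-preserving) $K$-algebra endomorphism $\phi$ of $\mathcal A$. For $e\in\mathcal A$, let $(e)$ denote the two-sided ideal of $\mathcal A$ generated by $e$. Then the following hold. (1) For every locally finite $K$-derivation $D$ of $\mathcal A$ and every idempotent $e\in\ker D\cap\operatorname{im}D$, we have $(e)\subseteq\operatorname{im}D$. (2) For every locally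 finite $K$-$\mathcal E$-derivation $\delta$ of $\mathcal A$ and every idempotent $e\in\ker\delta\cap\operatorname{im}\delta$, we have $e\mathcal A\subseteq\operatorname{im}\delta$ and $\mathcal Ae\subseteq\operatorname{im}\delta$. If moreover $\delta$ is locally nilpotent, then also $(e)\subseteq\operatorname{im}\delta$. -/

import Mathlib

/-- A `K`-linear endomorphism `η` is locally nilpotent if every vector is killed by some power
`η ^ m`, `m ≥ 1`. -/
def IsLocallyNilpotentEnd {K A : Type*} [Field K] [AddCommGroup A] [Module K A]
    (η : A →ₗ[K] A) : Prop :=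
  ∀ a : A, ∃ m : ℕ, 1 ≤ m ∧ (η ^ m) a = 0

/-- A `K`-linear endomorphism `η` is locally finite if for every vector `a` the `K`-subspace
spanned by `a, η a, η² a, …` is finite dimensional. -/
def IsLocallyFiniteEnd {K A : Type*} [Field K] [AddCommGroup A] [Module K A]
    (η : A →ₗ[K] A) : Prop :=
  ∀ a : A, FiniteDimensional K (Submodule.span K (Set.range fun i : ℕ => (η ^ i) a))

/-- A `K`-linear map `D : A → A` on a (possibly non-unital, non-commutative) algebra is a
`K`-derivation if it satisfies the Leibniz rule. -/
def IsKDerivation {K A : Type*} [Field K] [NonUnitalRing A] [Module K A]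
    (D : A →ₗ[K] A) : Prop :=
  ∀ a b : A, D (a * b) = D a * b + a * D b

/-- A `K`-linear map `δ : A → A` is a `K`-`ℰ`-derivation if it satisfies the twisted Leibniz rule
below; this says exactly that `Id - δ` is multiplicative. -/
def IsKEDerivation {K A : Type*} [Field K] [NonUnitalRing A] [Module K A]
    (δ : A →ₗ[K] A) : Prop :=
  ∀ a b : A, δ (a * b) = δ a * b + a * δ b - δ a * δ b

/-- The `ℰ`-derivations are the maps `Id - φ` with `φ` a (possibly non-unital) `K`-algebra
endomorphism. -/
theorem isKEDerivation_iff_exists {K A : Type*} [Field K] [NonUnitalRing A] [Module K A]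
    (δ : A →ₗ[K] A) :
    IsKEDerivation δ ↔ ∃ φ : A →ₙₐ[K] A, ∀ a : A, δ a = a - φ a := by
  constructor
  · intro h
    refine ⟨{ toFun := fun a => a - δ a, map_smul' := ?_, map_zero' := by simp,
              map_add' := ?_, map_mul' := ?_ }, ?_⟩
    · intro c a; simp [smul_sub]
    · intro a b; simp only [map_add]; abel
    · intro a b
      simp only [h a b, sub_mul, mul_sub]
      abel
    · intro a
      change δ a = a - (a - δ a)
      abel
  · rintro ⟨φ, h⟩ a b
    simp only [h, map_mul, sub_mul, mul_sub]
    abel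

/-!
Derivations and `ℰ`-derivations are the cases `t = 0` and `t = -1` of the twisted Leibniz rule
`δ (a * b) = δ a * b + a * δ b + t • (δ a * δ b)`. If `e = δ b` is an idempotent killed by `δ`, then
`b` may be replaced by `e * b * e`, and the binomial polynomials of step `t` in `b` form a chain
`c 0 = e`, `δ (c (k + 1)) = c k`.

The operator `T` induced by `δ` on `A ⊗ A` is again locally finite, so by Fitting's lemma every
`u : A ⊗ A` is the sum of a vector killed by a power of `T` and a vector `T w`. Write `u · x` for
the action `(a ⊗ a') · x = a * x * a'`. Then `T w · e = δ (w · e)`, while for `T ^ n v = 0`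
integration by parts along the chain `c` shows that `v · e` is in the range of `δ`.
-/

open TensorProduct

section Endomorphisms

variable {K M : Type*} [CommRing K] [AddCommGroup M] [Module K M]

theorem span_range_pow_apply_mem_invtSubmodule (η : Module.End K M) (a : M) :
    Submodule.span K (Set.range fun i : ℕ => (η ^ i) a) ∈ η.invtSubmodule := by
  refine Submodule.span_le.mpr ?_
  rintro _ ⟨i, rfl⟩
  exact Submodule.subset_span ⟨i + 1, by simp only [pow_succ', Module.End.mul_apply]⟩

theorem maxGenEigenspace_zero_sup_range_eq_top [IsArtinian K M] [IsNoetherian K M]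
    (η : Module.End K M) : η.maxGenEigenspace 0 ⊔ LinearMap.range η = ⊤ := by
  obtain ⟨n, hcompl, hn⟩ := ((LinearMap.eventually_isCompl_ker_pow_range_pow η).and
    (Filter.eventually_ne_atTop 0)).exists
  have hker : LinearMap.ker (η ^ n) ≤ η.maxGenEigenspace 0 := fun x hx =>
    (Module.End.mem_maxGenEigenspace _ _ _).mpr ⟨n, by simpa using hx⟩
  have hrange : LinearMap.range (η ^ n) ≤ LinearMap.range η := by
    rw [← mul_pow_sub_one hn]
    exact LinearMap.range_comp_le_range _ _
  exact eq_top_mono (sup_le_sup hker hrange) hcompl.sup_eq_top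

end Endomorphisms

section LocallyFinite

variable {K M : Type*} [Field K] [AddCommGroup M] [Module K M]

theorem isLocallyFiniteEnd_iff_exists_mem_invtSubmodule {η : Module.End K M} :
    IsLocallyFiniteEnd η ↔ ∀ a, ∃ P ∈ η.invtSubmodule, a ∈ P ∧ FiniteDimensional K P := by
  refine ⟨fun h a => ⟨_, span_range_pow_apply_mem_invtSubmodule η a,
    Submodule.subset_span ⟨0, rfl⟩, h a⟩, fun h a => ?_⟩
  obtain ⟨P, hP, ha, hfin⟩ := h a
  have horbit : Submodule.span K (Set.range fun i : ℕ => (η ^ i) a) ≤ P := by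
    refine Submodule.span_le.mpr ?_
    rintro _ ⟨i, rfl⟩
    exact Module.End.pow_apply_mem_of_forall_mem i hP a ha
  exact Submodule.finiteDimensional_of_le horbit

theorem IsLocallyFiniteEnd.maxGenEigenspace_zero_sup_range_eq_top {η : Module.End K M}
    (hη : IsLocallyFiniteEnd η) : η.maxGenEigenspace 0 ⊔ LinearMap.range η = ⊤ := by
  refine eq_top_iff.mpr fun u _ => ?_
  obtain ⟨P, hP, hu, _⟩ := isLocallyFiniteEnd_iff_exists_mem_invtSubmodule.mp hη u
  let ηP : Module.End K P := LinearMap.restrict η hP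
  have hmem : (⟨u, hu⟩ : P) ∈ ηP.maxGenEigenspace 0 ⊔ LinearMap.range ηP :=
    _root_.maxGenEigenspace_zero_sup_range_eq_top ηP ▸ Submodule.mem_top
  obtain ⟨v, hv, _, ⟨w, rfl⟩, hvw⟩ := Submodule.mem_sup.mp hmem
  have hvη : (v : M) ∈ η.maxGenEigenspace 0 :=
    (Module.End.genEigenspace_restrict η P ⊤ 0 hP).le hv
  exact Submodule.mem_sup.mpr ⟨v, hvη, η w, ⟨w, rfl⟩, congrArg Subtype.val hvw⟩

end LocallyFinite

section Leibniz

variable {K M N P : Type*} [CommRing K] [AddCommGroup M] [Module K M] [AddCommGroup N] [Module K N]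
  [AddCommGroup P] [Module K P]

/-- The Leibniz rule of weight `t` for a bilinear map `B` and endomorphisms `f`, `g`, `h` of its two
arguments and its target: for invertible `t` it says that `B` intertwines `1 + t • f` and
`1 + t • g` with `1 + t • h`, and for `t = 0` it is the usual product rule. -/
def IsWeightedLeibniz (t : K) (B : M →ₗ[K] N →ₗ[K] P) (f : Module.End K M) (g : Module.End K N)
    (h : Module.End K P) : Prop :=
  ∀ x y, h (B x y) = B (f x) y + B x (g y) + t • B (f x) (g y)

namespace IsWeightedLeibniz

variable {t : K} {B : M →ₗ[K] N →ₗ[K] P} {f : Module.End K M} {g : Module.End K N}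
  {h : Module.End K P}

theorem apply_mem_range_of_pow_apply_eq_zero (hB : IsWeightedLeibniz t B f g h) {c : ℕ → N}
    (hc : ∀ k, g (c (k + 1)) = c k) {n : ℕ} {v : M} (hv : (f ^ n) v = 0) (k : ℕ) :
    B v (c k) ∈ LinearMap.range h := by
  induction n generalizing v k with
  | zero =>
    obtain rfl : v = 0 := hv
    simp only [map_zero, LinearMap.zero_apply, zero_mem]
  | succ n ih =>
    have hfv : ∀ j, B (f v) (c j) ∈ LinearMap.range h := ih (by rwa [pow_succ] at hv)
    have hparts : B v (c k) =
        h (B v (c (k + 1))) - B (f v) (c (k + 1)) - t • B (f v) (c k) := by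
      rw [hB, hc]
      abel
    rw [hparts]
    exact sub_mem (sub_mem ⟨_, rfl⟩ (hfv _)) (Submodule.smul_mem _ t (hfv _))

theorem apply_apply_mem_range (hB : IsWeightedLeibniz t B f g h) {y : N} (hy : g y = 0) (x : M) :
    B (f x) y ∈ LinearMap.range h :=
  ⟨B x y, by simp only [hB x y, hy, map_zero, smul_zero, add_zero]⟩

theorem apply_mem_range (hB : IsWeightedLeibniz t B f g h)
    (hf : f.maxGenEigenspace 0 ⊔ LinearMap.range f = ⊤) {c : ℕ → N} (hc₀ : g (c 0) = 0)
    (hc : ∀ k, g (c (k + 1)) = c k) (u : M) : B u (c 0) ∈ LinearMap.range h := by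
  obtain ⟨v, hv, _, ⟨w, rfl⟩, rfl⟩ := Submodule.mem_sup.mp (hf ▸ Submodule.mem_top (x := u))
  obtain ⟨n, hn⟩ := (Module.End.mem_maxGenEigenspace _ _ _).mp hv
  rw [zero_smul, sub_zero] at hn
  rw [map_add, LinearMap.add_apply]
  exact add_mem (hB.apply_mem_range_of_pow_apply_eq_zero hc hn 0) (hB.apply_apply_mem_range hc₀ w)

end IsWeightedLeibniz

/-- The endomorphism `f ⊗ 1 + 1 ⊗ g + t • (f ⊗ g)` of `M ⊗ N`, through which `f` and `g` act on a
tensor product by the Leibniz rule of weight `t`. -/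
noncomputable def weightedTensorEnd (t : K) (f : Module.End K M) (g : Module.End K N) :
    Module.End K (M ⊗[K] N) :=
  f.rTensor N + g.lTensor M + t • TensorProduct.map f g

@[simp]
theorem weightedTensorEnd_tmul (t : K) (f : Module.End K M) (g : Module.End K N) (x : M) (y : N) :
    weightedTensorEnd t f g (x ⊗ₜ y) = f x ⊗ₜ y + x ⊗ₜ g y + t • (f x ⊗ₜ g y) :=
  rfl

theorem map₂_mk_mem_invtSubmodule_weightedTensorEnd (t : K) {f : Module.End K M}
    {g : Module.End K N} {p : Submodule K M} {q : Submodule K N} (hp : p ∈ f.invtSubmodule)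
    (hq : q ∈ g.invtSubmodule) :
    Submodule.map₂ (mk K M N) p q ∈ (weightedTensorEnd t f g).invtSubmodule :=
  Submodule.map₂_le.mpr fun x hx y hy => by
    have hmk {x y} (hx : x ∈ p) (hy : y ∈ q) := Submodule.apply_mem_map₂ (mk K M N) hx hy
    exact add_mem (add_mem (hmk (hp hx) hy) (hmk hx (hq hy)))
      (Submodule.smul_mem _ t (hmk (hp hx) (hq hy)))

end Leibniz

theorem IsLocallyFiniteEnd.weightedTensorEnd {K M N : Type*} [Field K] [AddCommGroup M] [Module K M]
    [AddCommGroup N] [Module K N] {f : Module.End K M} {g : Module.End K N}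
    (hf : IsLocallyFiniteEnd f) (hg : IsLocallyFiniteEnd g) (t : K) :
    IsLocallyFiniteEnd (weightedTensorEnd t f g) := by
  rw [isLocallyFiniteEnd_iff_exists_mem_invtSubmodule] at hf hg ⊢
  intro u
  induction u with
  | zero => exact ⟨⊥, Module.End.invtSubmodule.bot_mem _, zero_mem _, inferInstance⟩
  | add u v hu hv =>
    obtain ⟨P, hP, hu, _⟩ := hu
    obtain ⟨Q, hQ, hv, _⟩ := hv
    exact ⟨P ⊔ Q, Sublattice.sup_mem hP hQ,
      add_mem (Submodule.mem_sup_left hu) (Submodule.mem_sup_right hv), inferInstance⟩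
  | tmul x y =>
    obtain ⟨P, hP, hx, hPfin⟩ := hf x
    obtain ⟨Q, hQ, hy, hQfin⟩ := hg y
    exact ⟨_, map₂_mk_mem_invtSubmodule_weightedTensorEnd t hP hQ,
      Submodule.apply_mem_map₂ (mk K M N) hx hy, Module.Finite.iff_fg.mpr
        ((Module.Finite.iff_fg.mp hPfin).map₂ _ (Module.Finite.iff_fg.mp hQfin))⟩

section WeightedDerivation

variable {K A : Type*} [CommRing K] [NonUnitalRing A] [Module K A]

/-- A derivation of weight `t`. Weight `0` gives derivations and weight `-1` gives
`ℰ`-derivations. -/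
def IsWeightedDerivation (t : K) (δ : Module.End K A) : Prop :=
  ∀ a b, δ (a * b) = δ a * b + a * δ b + t • (δ a * δ b)

theorem IsWeightedDerivation.exists_apply_eq_and_mul_eq {t : K} {δ : Module.End K A}
    (hδ : IsWeightedDerivation t δ) {e : A} (he : IsIdempotentElem e) (hker : e ∈ LinearMap.ker δ)
    (hran : e ∈ LinearMap.range δ) : ∃ b, δ b = e ∧ e * b = b ∧ b * e = b := by
  obtain ⟨b, hb⟩ := hran
  rw [LinearMap.mem_ker] at hker
  refine ⟨e * b * e, ?_, by rw [← mul_assoc, ← mul_assoc, he.eq], by rw [mul_assoc, he.eq]⟩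
  simp only [hδ _ _, hker, hb, he.eq, zero_mul, mul_zero, smul_zero, zero_add, add_zero]

variable [IsScalarTower K A A] [SMulCommClass K A A]

/-- The action of `A ⊗ A` on `A` given by `(a ⊗ a') · x = a * x * a'`; the enveloping algebra action
for an algebra which need not have a unit. -/
noncomputable def sandwich (K A : Type*) [CommRing K] [NonUnitalRing A] [Module K A]
    [IsScalarTower K A A] [SMulCommClass K A A] : A ⊗[K] A →ₗ[K] A →ₗ[K] A :=
  TensorProduct.lift
    ((LinearMap.mul K (Module.End K A)).compl₁₂ (LinearMap.mul K A) (LinearMap.mul K A).flip)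

@[simp]
theorem sandwich_tmul_apply (a a' x : A) : sandwich K A (a ⊗ₜ a') x = a * x * a' :=
  (mul_assoc a x a').symm

theorem IsWeightedDerivation.isWeightedLeibniz_sandwich {t : K} {δ : Module.End K A}
    (hδ : IsWeightedDerivation t δ) :
    IsWeightedLeibniz t (sandwich K A) (weightedTensorEnd t δ δ) δ δ := by
  intro u x
  induction u with
  | zero => simp only [map_zero, LinearMap.zero_apply, smul_zero, add_zero]
  | add u v hu hv =>
    simp only [map_add, LinearMap.add_apply, hu, hv, smul_add]
    abel
  | tmul a a' =>
    simp only [weightedTensorEnd_tmul, map_add, map_smul, LinearMap.add_apply, LinearMap.smul_apply,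
      sandwich_tmul_apply, hδ _ _, add_mul, smul_mul_assoc, smul_add]
    abel

end WeightedDerivation

theorem IsKDerivation.isWeightedDerivation {K A : Type*} [Field K] [NonUnitalRing A] [Module K A]
    {D : A →ₗ[K] A} (hD : IsKDerivation D) : IsWeightedDerivation 0 D := fun a b => by
  rw [hD, zero_smul, add_zero]

theorem IsKEDerivation.isWeightedDerivation {K A : Type*} [Field K] [NonUnitalRing A] [Module K A]
    {δ : A →ₗ[K] A} (hδ : IsKEDerivation δ) : IsWeightedDerivation (-1) δ := fun a b => by
  rw [hδ, neg_one_smul, sub_eq_add_neg]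

section SteppedChoose

variable {K A : Type*} [Field K] [NonUnitalRing A] [Module K A]

/-- The binomial polynomial `b (b - t) ⋯ (b - (k - 1) t) / k!` of step `t` in `b`, where `e` plays
the role of `1`: divided powers for `t = 0` and rising binomials for `t = -1`. -/
def steppedChoose (t : K) (e b : A) : ℕ → A
  | 0 => e
  | k + 1 => ((k : K) + 1)⁻¹ • (steppedChoose t e b k * b - (k * t) • steppedChoose t e b k)

theorem steppedChoose_mul_right [CharZero K] (t : K) (e b : A) (k : ℕ) :
    steppedChoose t e b k * b =
      ((k : K) + 1) • steppedChoose t e b (k + 1) + (k * t) • steppedChoose t e b k := by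
  rw [steppedChoose, smul_inv_smul₀ (Nat.cast_add_one_ne_zero k), sub_add_cancel]

variable [IsScalarTower K A A]

theorem steppedChoose_mul_idempotent (t : K) {e b : A} (he : IsIdempotentElem e)
    (hbe : b * e = b) (k : ℕ) : steppedChoose t e b k * e = steppedChoose t e b k := by
  induction k with
  | zero => exact he
  | succ k ih => rw [steppedChoose, smul_mul_assoc, sub_mul, mul_assoc, hbe, smul_mul_assoc, ih]

theorem IsWeightedDerivation.apply_steppedChoose_succ [CharZero K] {t : K} {δ : Module.End K A}
    (hδ : IsWeightedDerivation t δ) {e b : A} (he : IsIdempotentElem e) (heb : e * b = b)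
    (hbe : b * e = b) (hb : δ b = e) (k : ℕ) :
    δ (steppedChoose t e b (k + 1)) = steppedChoose t e b k := by
  induction k with
  | zero => simp [steppedChoose, heb, hb]
  | succ k ih =>
    have hk : ((k + 1 : ℕ) : K) + 1 ≠ 0 := Nat.cast_add_one_ne_zero (k + 1)
    rw [steppedChoose, map_smul, map_sub, map_smul, hδ, ih, hb, steppedChoose_mul_right,
      steppedChoose_mul_idempotent t he hbe, steppedChoose_mul_idempotent t he hbe,
      inv_smul_eq_iff₀ hk]
    push_cast
    module

end SteppedChoose

theorem span_singleton_subset_of_forall_mul_mul_mem {A : Type*} [NonUnitalRing A] {e : A}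
    (he : IsIdempotentElem e) {R : AddSubgroup A} (h : ∀ a a', a * e * a' ∈ R) :
    (TwoSidedIdeal.span {e} : Set A) ⊆ R := by
  have hleft (a : A) : e * a ∈ R := by simpa only [he.eq] using h e a
  have hright (a : A) : a * e ∈ R := by simpa only [mul_assoc, he.eq] using h a e
  intro x hx
  refine (AddSubgroup.closure_le R).mpr ?_
    (TwoSidedIdeal.mem_span_iff_mem_addSubgroup_closure_nonunital.mp hx)
  rintro _ (((rfl | ⟨_, rfl, a, -, rfl⟩) | ⟨a, -, _, rfl, rfl⟩) |
    ⟨_, ⟨a, -, _, rfl, rfl⟩, a', -, rfl⟩)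
  exacts [he.eq ▸ hleft _, hleft a, hright a, h a a']

theorem theorem1p2_general {K A : Type*} [Field K] [CharZero K] [NonUnitalRing A] [Module K A]
    [IsScalarTower K A A] [SMulCommClass K A A] {t : K} {δ : A →ₗ[K] A}
    (hδ : IsWeightedDerivation t δ) (hfin : IsLocallyFiniteEnd δ) {e : A}
    (he : IsIdempotentElem e) (hker : e ∈ LinearMap.ker δ) (hran : e ∈ LinearMap.range δ) :
    (TwoSidedIdeal.span {e} : Set A) ⊆ LinearMap.range δ := by
  obtain ⟨b, hb, heb, hbe⟩ := hδ.exists_apply_eq_and_mul_eq he hker hran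
  have hchain := hδ.apply_steppedChoose_succ he heb hbe hb
  refine span_singleton_subset_of_forall_mul_mul_mem (R := (LinearMap.range δ).toAddSubgroup) he
    fun a a' => ?_
  have hmem := hδ.isWeightedLeibniz_sandwich.apply_mem_range
    (hfin.weightedTensorEnd hfin t).maxGenEigenspace_zero_sup_range_eq_top
    (c := steppedChoose t e b) hker hchain (a ⊗ₜ a')
  rwa [sandwich_tmul_apply] at hmem

theorem theorem1p2 {K A : Type*} [Field K] [CharZero K]
    [NonUnitalRing A] [Module K A] [IsScalarTower K A A] [SMulCommClass K A A] :
    (∀ D : A →ₗ[K] A, IsKDerivation D → IsLocallyFiniteEnd D →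
      ∀ e : A, IsIdempotentElem e → e ∈ LinearMap.ker D → e ∈ LinearMap.range D →
        (TwoSidedIdeal.span {e} : Set A) ⊆ (LinearMap.range D : Set A)) ∧
    (∀ δ : A →ₗ[K] A, IsKEDerivation δ → IsLocallyFiniteEnd δ →
      ∀ e : A, IsIdempotentElem e → e ∈ LinearMap.ker δ → e ∈ LinearMap.range δ →
        (∀ a : A, e * a ∈ LinearMap.range δ ∧ a * e ∈ LinearMap.range δ) ∧
        (IsLocallyNilpotentEnd δ →
          (TwoSidedIdeal.span {e} : Set A) ⊆ (LinearMap.range δ : Set A))) :=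
  ⟨fun _ hD hfin _ he hker hran =>
    theorem1p2_general hD.isWeightedDerivation hfin he hker hran,
  fun _ hδ hfin e he hker hran =>
    have hspan := theorem1p2_general hδ.isWeightedDerivation hfin he hker hran
    have hmem : e ∈ TwoSidedIdeal.span {e} := TwoSidedIdeal.subset_span rfl
    ⟨fun _ => ⟨hspan (TwoSidedIdeal.mul_mem_right _ _ _ hmem),
      hspan (TwoSidedIdeal.mul_mem_left _ _ _ hmem)⟩, fun _ => hspan⟩⟩
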